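/- Let $\mathcal P$ be a probability distribution on $\mathbb R^p$ and let $T$ be a real number such that $\|\xi\|_2^2<T$ almost surely for $\xi\sim\mathcal P$. Let $m\ge 1$, $0\le k\le p$, $\delta\ge 0$, and let $\hat\xi_1,\dots,\hat\xi_m$ (the anchor gradients) be independent random vectors with law $\mathcal P$. Put $\Sigma:=\mathbb E_{\xi\sim\mathcal P}[\xi\xi^T]$ and $\hat S:=\frac1m\sum_{j=1}^m\hat\xi_j\hat\xi_j^T$, and let $\lambda_i(\cdot)$ denote the $i$-th largest eigenvalue of a symmetric matrix, counted with multiplicity. Then with probability at least $1-2\exp(-\delta)$ the following holds: for every orthonormal family $\hat V_k=(\hat v_1,\dots,\hat v_k)$ with $\hat S\hat v_i=\lambda_i(\hat S)\hat v_i$ for $i=1,\dots,k$, $$\mathbb E_{\xi\sim\mathcal P}\bigl\|\xi-\Pi_{\hat V_k}(\xi)\bigr\|_2^2\;\le\;\sum_{k'=k+1}^{p}\lambda_{k'}(\Sigma)+\sqrt{\frac{kC}{m}}+T\sqrt{\frac{2\delta}{m}},$$ where $\Pi_{\hat V_k}$ is the orthogonal projection onto the span of $\hat V_k$, the expectation is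 over a fresh $\xi\sim\mathcal P$ with the sample $\hat\xi_1,\dots,\hat\xi_m$ held fixed, and $$C=\Bigl[\mathbb E_{\xi\sim\mathcal P}\|\xi\|_2^4-\sum_{i=1}^p\lambda_i(\Sigma)^2\Bigr]+\Bigl[\frac1m\sum_{j=1}^m\|\hat\xi_j\|_2^4-\sum_{i=1}^p\lambda_i(\hat S)^2\Bigr].$$ -/

import Mathlib

open MeasureTheory ProbabilityTheory

noncomputable section

namespace AnchorPCA

/-- The uncentered covariance matrix `E[x xᵀ]` of a law `P` on `ℝᵖ`. -/
def populationCov {p : ℕ} (P : Measure (EuclideanSpace ℝ (Fin p))) :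
    Matrix (Fin p) (Fin p) ℝ :=
  Matrix.of fun a b => ∫ x, x a * x b ∂P

/-- The uncentered empirical covariance matrix `(1/m) ∑ j, x_j x_jᵀ`. -/
def empiricalCov {p m : ℕ} (x : Fin m → EuclideanSpace ℝ (Fin p)) :
    Matrix (Fin p) (Fin p) ℝ :=
  Matrix.of fun a b => (1 / (m : ℝ)) * ∑ j, x j a * x j b

theorem populationCov_isHermitian {p : ℕ} (P : Measure (EuclideanSpace ℝ (Fin p))) :
    (populationCov P).IsHermitian := by
  ext a b
  simp [populationCov, mul_comm]

theorem empiricalCov_isHermitian {p m : ℕ} (x : Fin m → EuclideanSpace ℝ (Fin p)) :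
    (empiricalCov x).IsHermitian := by
  ext a b
  simp [empiricalCov, mul_comm]

/-- The eigenvalues of a real symmetric `p × p` matrix in decreasing order, with multiplicity:
`sortedEig hA i` is the `(i+1)`-th largest eigenvalue, since indices start at `0`. -/
def sortedEig {p : ℕ} {A : Matrix (Fin p) (Fin p) ℝ} (hA : A.IsHermitian) (i : Fin p) : ℝ :=
  hA.eigenvalues₀ (Fin.cast (Fintype.card_fin p).symm i)

/-- `v` is an orthonormal family of eigenvectors for the `k` largest eigenvalues of `A`.
Where eigenvalues coincide there are several such families. -/
def IsTopEigenvectors {p k : ℕ} {A : Matrix (Fin p) (Fin p) ℝ} (hA : A.IsHermitian)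
    (hk : k ≤ p) (v : Fin k → EuclideanSpace ℝ (Fin p)) : Prop :=
  Orthonormal ℝ v ∧
    ∀ i : Fin k, Matrix.toEuclideanLin A (v i) = sortedEig hA (Fin.castLE hk i) • v i

/-- The expected squared residual of `x ∼ P` after orthogonal projection onto the span of `v`. -/
def expectedResidual {p k : ℕ} (P : Measure (EuclideanSpace ℝ (Fin p)))
    (v : Fin k → EuclideanSpace ℝ (Fin p)) : ℝ :=
  ∫ x, ‖x - (Submodule.span ℝ (Set.range v)).starProjection x‖ ^ 2 ∂P

/-- The constant `C`, the sum of a population and an empirical fourth-moment term. -/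
def fourthMomentTerm {p m : ℕ} (P : Measure (EuclideanSpace ℝ (Fin p)))
    (x : Fin m → EuclideanSpace ℝ (Fin p)) : ℝ :=
  ((∫ y, ‖y‖ ^ 4 ∂P) - ∑ i, sortedEig (populationCov_isHermitian P) i ^ 2) +
    ((1 / (m : ℝ)) * ∑ j, ‖x j‖ ^ 4 - ∑ i, sortedEig (empiricalCov_isHermitian x) i ^ 2)

end AnchorPCA

end

/-! This is an empirical-risk argument. For an orthonormal family the residual is the trace of Σ
minus the mean energy captured, so the top eigenvectors `u` of Σ attain the tail eigenvalue sum. By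
Ky Fan, `v` captures at least as much energy on the sample as `u`. Its excess residual over `u` is
therefore at most `supDeviation P u`, the largest gap over all orthonormal families between sample
mean and expectation of the energy gained over `u`.

The mean of this supremum is controlled by Cauchy-Schwarz: the gap for one family is at most √k
times the Frobenius norm of Ŝ − Σ, up to a term in `u` of mean zero. By Jensen the mean is then at
most √(k/m) times the root of the total variance of the entries of ξξᵀ, and that variance is the
population half of C. The empirical half is nonnegative and only weakens the bound.

McDiarmid's inequality gives the fluctuation: replacing one sample point moves the supremum by at
most 2T/m, so it exceeds its mean by T√(2δ/m) with probability at most exp(-δ). The norm bound holds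
only almost surely, so McDiarmid is applied to a truncated sample, which almost surely equals the
original. -/

section BoundedDifferences

/-- `f` changes by at most `c j` when only its `j`-th argument changes. -/
def HasBoundedDifferences {E : Type*} {n : ℕ} (f : (Fin n → E) → ℝ) (c : Fin n → NNReal) : Prop :=
  ∀ (x : Fin n → E) (j : Fin n) (a : E), |f (Function.update x j a) - f x| ≤ c j

/-! ### McDiarmid's inequality -/

namespace HasBoundedDifferences

variable {E : Type*} {n : ℕ}

lemma abs_cons_sub_cons_le {f : (Fin (n + 1) → E) → ℝ} {c : Fin (n + 1) → NNReal}
    (hf : HasBoundedDifferences f c) (a b : E) (y : Fin n → E) :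
    |f (Fin.cons a y : Fin (n + 1) → E) - f (Fin.cons b y : Fin (n + 1) → E)| ≤ c 0 := by
  simpa using hf (Fin.cons b y) 0 a

lemma comp_cons {f : (Fin (n + 1) → E) → ℝ} {c : Fin (n + 1) → NNReal}
    (hf : HasBoundedDifferences f c) (a : E) :
    HasBoundedDifferences (fun y : Fin n → E ↦ f (Fin.cons a y : Fin (n + 1) → E))
      (fun j ↦ c j.succ) := by
  intro y j b
  have := hf (Fin.cons a y) j.succ b
  rwa [← Fin.cons_update] at this

/-- Any point is reached from any other by changing finitely many coordinates. Boundedness supplies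
integrability throughout the induction. -/
lemma exists_abs_le {f : (Fin n → E) → ℝ} {c : Fin n → NNReal} (hf : HasBoundedDifferences f c) :
    ∃ B, ∀ x, |f x| ≤ B := by
  induction n with
  | zero => exact ⟨|f default|, fun x ↦ by rw [Subsingleton.elim x default]⟩
  | succ n ih =>
    cases isEmpty_or_nonempty E with
    | inl h => exact ⟨0, fun x ↦ h.elim (x 0)⟩
    | inr h =>
      obtain ⟨a⟩ := h
      obtain ⟨B, hB⟩ := ih (hf.comp_cons a)
      refine ⟨B + c 0, fun x ↦ ?_⟩
      have h1 := hf.abs_cons_sub_cons_le (x 0) a (Fin.tail x)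
      have h2 := hB (Fin.tail x)
      rw [Fin.cons_self_tail] at h1
      have h3 := abs_sub_abs_le_abs_sub (f x) (f (Fin.cons a (Fin.tail x) : Fin (n + 1) → E))
      linarith

lemma abs_exp_le {f : (Fin n → E) → ℝ} {B : ℝ} (hB : ∀ x, |f x| ≤ B) (t m : ℝ) (x : Fin n → E) :
    |Real.exp (t * (f x - m))| ≤ Real.exp (|t| * (B + |m|)) := by
  rw [abs_of_pos (Real.exp_pos _), Real.exp_le_exp]
  calc t * (f x - m) ≤ |t * (f x - m)| := le_abs_self _
    _ = |t| * |f x - m| := abs_mul _ _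
    _ ≤ _ := by
      gcongr
      exact (abs_sub _ _).trans (by gcongr; exact hB x)

variable [MeasurableSpace E]

lemma integrable {f : (Fin n → E) → ℝ} {c : Fin n → NNReal} (hf : HasBoundedDifferences f c)
    (hfm : Measurable f) (ν : Measure (Fin n → E)) [IsFiniteMeasure ν] : Integrable f ν := by
  obtain ⟨B, hB⟩ := hf.exists_abs_le
  exact Integrable.of_bound hfm.aestronglyMeasurable B (.of_forall hB)

/-- **McDiarmid's inequality**: a function of independent variables with bounded differences `c`
is sub-Gaussian with parameter `∑ j, (c j / 2) ^ 2` around its mean. -/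
theorem hasSubgaussianMGF {f : (Fin n → E) → ℝ} {c : Fin n → NNReal}
    (hf : HasBoundedDifferences f c) (hfm : Measurable f)
    (P : Fin n → Measure E) [∀ j, IsProbabilityMeasure (P j)] :
    HasSubgaussianMGF (fun x ↦ f x - ∫ y, f y ∂Measure.pi P) (∑ j, (c j / 2) ^ 2)
      (Measure.pi P) := by
  induction n with
  | zero =>
    have : ∀ x, f x - ∫ y, f y ∂Measure.pi P = 0 := fun x ↦ by
      have : f = fun _ ↦ f x := funext fun y ↦ by rw [Subsingleton.elim y x]
      rw [this]; simp
    simp [this]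
  | succ n ih =>
    have hint := hf.integrable hfm (Measure.pi P)
    obtain ⟨B, hB⟩ := hf.exists_abs_le
    set P' : Fin n → Measure E := fun j ↦ P j.succ with hP'
    have hE : Nonempty E := (P 0).nonempty_of_neZero
    have hcons : MeasurePreserving
        (fun z : E × (Fin n → E) ↦ (Fin.cons z.1 z.2 : Fin (n + 1) → E))
        ((P 0).prod (Measure.pi P')) (Measure.pi P) := by
      have := (measurePreserving_piFinSuccAbove P 0).symm
      simpa [MeasurableEquiv.piFinSuccAbove, Fin.insertNthEquiv] using! this
    have hcm := hcons.measurable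
    have hemb : MeasurableEmbedding
        (fun z : E × (Fin n → E) ↦ (Fin.cons z.1 z.2 : Fin (n + 1) → E)) := by
      have := (MeasurableEquiv.piFinSuccAbove (fun _ : Fin (n + 1) ↦ E) 0).symm.measurableEmbedding
      simpa [MeasurableEquiv.piFinSuccAbove, Fin.insertNthEquiv] using! this
    have hsplit : ∀ h : (Fin (n + 1) → E) → ℝ, Integrable h (Measure.pi P) →
        ∫ x, h x ∂Measure.pi P =
          ∫ y, ∫ a, h (Fin.cons a y : Fin (n + 1) → E) ∂P 0 ∂Measure.pi P' := by
      intro h hh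
      rw [← hcons.integral_comp hemb, integral_prod_symm]
      exact hcons.integrable_comp_of_integrable hh
    -- Averaging out coordinate 0 leaves a function with the same mean and the remaining difference
    -- bounds, so induction applies to it.
    set g : (Fin n → E) → ℝ := fun y ↦ ∫ a, f (Fin.cons a y : Fin (n + 1) → E) ∂P 0 with hg
    have hfc : ∀ y, Measurable fun a ↦ f (Fin.cons a y : Fin (n + 1) → E) := fun y ↦
      (hfm.comp hcm).comp (measurable_id.prodMk measurable_const)
    have hgi : ∀ y, Integrable (fun a ↦ f (Fin.cons a y : Fin (n + 1) → E)) (P 0) := fun y ↦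
      Integrable.of_bound (hfc y).aestronglyMeasurable B (.of_forall fun _ ↦ hB _)
    have hgm : Measurable g :=
      ((hfm.comp hcm).stronglyMeasurable.integral_prod_left').measurable
    have hgb : HasBoundedDifferences g (fun j ↦ c j.succ) := by
      intro y j b
      simp only [hg]
      rw [← integral_sub (hgi _) (hgi _)]
      have := norm_integral_le_of_norm_le_const (μ := P 0) (C := c j.succ)
        (f := fun a ↦ f (Fin.cons a (Function.update y j b) : Fin (n + 1) → E) -
          f (Fin.cons a y : Fin (n + 1) → E)) (.of_forall fun a ↦ hf.comp_cons a y j b)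
      simpa using this
    have hih := ih hgb hgm P'
    have hmean : ∫ y, g y ∂Measure.pi P' = ∫ x, f x ∂Measure.pi P := (hsplit f hint).symm
    set M := ∫ x, f x ∂Measure.pi P with hM
    rw [hmean] at hih
    have hexp : ∀ t : ℝ, Integrable (fun x ↦ Real.exp (t * (f x - M))) (Measure.pi P) := fun t ↦
      Integrable.of_bound (by fun_prop) _ (.of_forall (abs_exp_le hB t M))
    refine ⟨hexp, fun t ↦ ?_⟩
    have hinner : ∀ y, ∫ a, Real.exp (t * (f (Fin.cons a y : Fin (n + 1) → E) - M)) ∂P 0 ≤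
        Real.exp (t * (g y - M)) * Real.exp ((c 0 / 2 : ℝ) ^ 2 * t ^ 2 / 2) := by
      intro y
      -- With the other coordinates frozen, `f` ranges over an interval of length `c 0`; Hoeffding's
      -- lemma then contributes the parameter `(c 0 / 2) ^ 2`.
      have hrange : ∀ a, f (Fin.cons a y : Fin (n + 1) → E) ∈
          Set.Icc (⨅ b, f (Fin.cons b y : Fin (n + 1) → E))
            ((⨅ b, f (Fin.cons b y : Fin (n + 1) → E)) + c 0) := by
        refine fun a ↦ ⟨ciInf_le ⟨-B, ?_⟩ a, ?_⟩
        · rintro _ ⟨b, rfl⟩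
          exact (abs_le.1 (hB _)).1
        · rw [← sub_le_iff_le_add]
          refine le_ciInf fun b ↦ ?_
          have := (abs_le.1 (hf.abs_cons_sub_cons_le a b y)).2
          linarith
      have hoeff := (hasSubgaussianMGF_of_mem_Icc (μ := P 0) (hfc y).aemeasurable
        (.of_forall hrange)).mgf_le t
      rw [mgf] at hoeff
      simp only [add_sub_cancel_left, NNReal.nnnorm_eq] at hoeff
      calc ∫ a, Real.exp (t * (f (Fin.cons a y : Fin (n + 1) → E) - M)) ∂P 0
          = Real.exp (t * (g y - M)) *
            ∫ a, Real.exp (t * (f (Fin.cons a y : Fin (n + 1) → E) - g y)) ∂P 0 := by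
            rw [← integral_const_mul]
            refine integral_congr_ae (.of_forall fun a ↦ ?_)
            simp only [← Real.exp_add]
            ring_nf
        _ ≤ _ := by
            refine mul_le_mul_of_nonneg_left (hoeff.trans_eq ?_) (Real.exp_pos _).le
            simp
    calc mgf (fun x ↦ f x - M) (Measure.pi P) t
        = ∫ y, ∫ a, Real.exp (t * (f (Fin.cons a y : Fin (n + 1) → E) - M)) ∂P 0
            ∂Measure.pi P' := hsplit _ (hexp t)
      _ ≤ ∫ y, Real.exp (t * (g y - M)) * Real.exp ((c 0 / 2 : ℝ) ^ 2 * t ^ 2 / 2)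
            ∂Measure.pi P' := by
          refine integral_mono_of_nonneg (.of_forall fun y ↦ ?_) ?_ (.of_forall hinner)
          · exact integral_nonneg fun _ ↦ (Real.exp_pos _).le
          · exact (hih.integrable_exp_mul t).mul_const _
      _ = mgf (fun y ↦ g y - M) (Measure.pi P') t * Real.exp ((c 0 / 2 : ℝ) ^ 2 * t ^ 2 / 2) :=
          integral_mul_const _ _
      _ ≤ Real.exp ((∑ j : Fin n, (c j.succ / 2) ^ 2 : NNReal) * t ^ 2 / 2) *
            Real.exp ((c 0 / 2 : ℝ) ^ 2 * t ^ 2 / 2) := by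
          gcongr
          exact hih.mgf_le t
      _ = Real.exp ((∑ j, (c j / 2) ^ 2 : NNReal) * t ^ 2 / 2) := by
          rw [← Real.exp_add, Fin.sum_univ_succ]
          push_cast
          ring_nf

end HasBoundedDifferences

end BoundedDifferences

namespace AnchorPCA

open scoped RealInnerProductSpace

variable {p k : ℕ}

/-! ### Sorted eigenvalues and Ky Fan's principle -/

section SortedEigenvalues

variable {A : Matrix (Fin p) (Fin p) ℝ}

lemma sortedEig_antitone (hA : A.IsHermitian) : Antitone (sortedEig hA) :=
  fun _ _ h ↦ hA.eigenvalues₀_antitone h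

lemma exists_orthonormalBasis_sortedEig (hA : A.IsHermitian) :
    ∃ b : OrthonormalBasis (Fin p) ℝ (EuclideanSpace ℝ (Fin p)),
      ∀ i, Matrix.toEuclideanLin A (b i) = sortedEig hA i • b i := by
  have hs := Matrix.isSymmetric_toEuclideanLin_iff.mpr hA
  refine ⟨(hs.eigenvectorBasis finrank_euclideanSpace).reindex
    (finCongr (Fintype.card_fin p)), fun i ↦ ?_⟩
  rw [OrthonormalBasis.reindex_apply]
  exact hs.apply_eigenvectorBasis finrank_euclideanSpace _

lemma inner_toEuclideanLin (A : Matrix (Fin p) (Fin p) ℝ) (y z : EuclideanSpace ℝ (Fin p)) :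
    ⟪y, Matrix.toEuclideanLin A z⟫ = ∑ a, ∑ b, y a * A a b * z b := by
  simp only [PiLp.inner_apply, Matrix.toLpLin_apply, Matrix.mulVec, dotProduct, RCLike.inner_apply,
    conj_trivial, Finset.sum_mul]
  refine Finset.sum_congr rfl fun a _ ↦ Finset.sum_congr rfl fun b _ ↦ by ring

lemma sum_inner_toEuclideanLin_orthonormalBasis
    (b : OrthonormalBasis (Fin p) ℝ (EuclideanSpace ℝ (Fin p))) (A : Matrix (Fin p) (Fin p) ℝ) :
    ∑ i, ⟪b i, Matrix.toEuclideanLin A (b i)⟫ = A.trace := by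
  rw [← LinearMap.trace_eq_sum_inner, LinearMap.trace_eq_sum_inner _ (EuclideanSpace.basisFun _ ℝ)]
  simp [Matrix.trace, inner_toEuclideanLin]

lemma sum_sortedEig (hA : A.IsHermitian) : ∑ i, sortedEig hA i = A.trace := by
  obtain ⟨b, hb⟩ := exists_orthonormalBasis_sortedEig hA
  rw [← sum_inner_toEuclideanLin_orthonormalBasis b]
  simp [hb, inner_smul_right]

/-- Both sides are the trace of `A * A`, computed once in an eigenbasis and once in coordinates
using symmetry. -/
lemma sum_sortedEig_sq (hA : A.IsHermitian) :
    ∑ i, sortedEig hA i ^ 2 = ∑ a, ∑ b, A a b ^ 2 := by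
  obtain ⟨b, hb⟩ := exists_orthonormalBasis_sortedEig hA
  have h := sum_inner_toEuclideanLin_orthonormalBasis b (A * A)
  have hmul : ∀ z, Matrix.toEuclideanLin (A * A) z =
      Matrix.toEuclideanLin A (Matrix.toEuclideanLin A z) := fun z ↦ by
    simp [Matrix.toLpLin_apply, Matrix.mulVec_mulVec]
  simp only [hmul, hb, map_smul, inner_smul_right, real_inner_self_eq_norm_sq,
    OrthonormalBasis.norm_eq_one, one_pow, mul_one] at h
  simp only [pow_two, h, Matrix.trace, Matrix.diag_apply, Matrix.mul_apply]
  refine Finset.sum_congr rfl fun a _ ↦ Finset.sum_congr rfl fun c _ ↦ ?_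
  have := hA.apply a c
  simp only [star_trivial] at this
  rw [this]

/-- A weighted sum of a decreasing sequence, with weights in `[0, 1]` of total mass `k`,
is at most the sum of its first `k` terms. -/
lemma sum_mul_le_sum_castLE {l w : Fin p → ℝ} (hl : Antitone l) (hk : k ≤ p)
    (hw0 : ∀ i, 0 ≤ w i) (hw1 : ∀ i, w i ≤ 1) (hw : ∑ i, w i = k) :
    ∑ i, l i * w i ≤ ∑ i : Fin k, l (Fin.castLE hk i) := by
  rcases Nat.eq_zero_or_pos k with rfl | hk0
  · have : ∀ i, w i = 0 := fun i ↦
      (Finset.sum_eq_zero_iff_of_nonneg fun i _ ↦ hw0 i).1 (by simpa using hw) i (Finset.mem_univ i)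
    simp [this]
  obtain ⟨q, rfl⟩ := Nat.exists_eq_add_of_le hk
  -- The `k`-th largest value (index `k - 1`, hence the separate case `k = 0`) is a pivot: weight
  -- missing from the first `k` terms equals weight placed later, where the values are at most `c`.
  set c := l ⟨k - 1, by omega⟩
  rw [Fin.sum_univ_add] at hw ⊢
  have h1 : ∀ i : Fin k, l (Fin.castAdd q i) * w (Fin.castAdd q i) ≤
      l (Fin.castLE hk i) - c * (1 - w (Fin.castAdd q i)) := fun i ↦ by
    have : c ≤ l (Fin.castAdd q i) := hl (by simp [Fin.le_def]; omega)
    have hi : Fin.castLE hk i = Fin.castAdd q i := rfl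
    rw [hi]
    nlinarith [hw1 (Fin.castAdd q i)]
  have h2 : ∀ i : Fin q, l (Fin.natAdd k i) * w (Fin.natAdd k i) ≤ c * w (Fin.natAdd k i) :=
    fun i ↦ mul_le_mul_of_nonneg_right (hl (by simp [Fin.le_def]; omega)) (hw0 _)
  have h3 := Finset.sum_le_sum fun i (_ : i ∈ Finset.univ) ↦ h1 i
  have h4 := Finset.sum_le_sum fun i (_ : i ∈ Finset.univ) ↦ h2 i
  simp only [Finset.sum_sub_distrib, ← Finset.mul_sum, Finset.sum_const, Finset.card_univ,
    Fintype.card_fin, nsmul_eq_mul, mul_one] at h3 h4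
  have h5 : c * ((k : ℝ) - ∑ i, w (Fin.castAdd q i)) = c * ∑ i, w (Fin.natAdd k i) := by
    rw [← hw]; ring
  linarith

/-- **Ky Fan's maximum principle**. -/
theorem sum_inner_toEuclideanLin_le (hA : A.IsHermitian) (hk : k ≤ p)
    {u : Fin k → EuclideanSpace ℝ (Fin p)} (hu : Orthonormal ℝ u) :
    ∑ i, ⟪u i, Matrix.toEuclideanLin A (u i)⟫ ≤ ∑ i : Fin k, sortedEig hA (Fin.castLE hk i) := by
  obtain ⟨b, hb⟩ := exists_orthonormalBasis_sortedEig hA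
  have hs := Matrix.isSymmetric_toEuclideanLin_iff.mpr hA
  have hexp : ∀ z, ⟪z, Matrix.toEuclideanLin A z⟫ = ∑ i, sortedEig hA i * ⟪b i, z⟫ ^ 2 := by
    intro z
    rw [← b.sum_inner_mul_inner z]
    refine Finset.sum_congr rfl fun i _ ↦ ?_
    rw [← hs (b i) z, hb, inner_smul_left, real_inner_comm]
    simp only [conj_trivial]
    ring
  simp only [hexp]
  rw [Finset.sum_comm]
  simp only [← Finset.mul_sum]
  -- The weight of `b i` is the sum over `j` of `⟪b i, u j⟫ ^ 2`: at most 1 by Bessel for `u`, with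
  -- total mass `k` by Parseval for `b`.
  refine sum_mul_le_sum_castLE (sortedEig_antitone hA) hk
    (fun i ↦ Finset.sum_nonneg fun _ _ ↦ sq_nonneg _) (fun i ↦ ?_) ?_
  · have := hu.sum_inner_products_le (b i) (s := Finset.univ)
    simpa [real_inner_comm] using this
  · rw [Finset.sum_comm]
    have : ∀ j, ∑ i, ⟪b i, u j⟫ ^ 2 = 1 := fun j ↦ by
      have := b.sum_sq_norm_inner_right (u j)
      simpa [hu.1 j] using this
    simp [this]

lemma sum_sortedEig_filter (hA : A.IsHermitian) (hk : k ≤ p) :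
    ∑ i : Fin p with k ≤ i.val, sortedEig hA i =
      A.trace - ∑ i : Fin k, sortedEig hA (Fin.castLE hk i) := by
  obtain ⟨q, rfl⟩ := Nat.exists_eq_add_of_le hk
  rw [← sum_sortedEig hA, Finset.sum_filter, Fin.sum_univ_add, Fin.sum_univ_add]
  have h : ∀ i : Fin k, ¬ k ≤ (Fin.castAdd q i).val := fun i ↦ by simp
  have h' : ∀ i : Fin q, k ≤ (Fin.natAdd k i).val := fun i ↦ by simp
  have hi : ∀ i : Fin k, Fin.castLE hk i = Fin.castAdd q i := fun _ ↦ rfl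
  simp only [h, h', hi, if_true, if_false, Finset.sum_const_zero]
  ring

end SortedEigenvalues

/-! ### Captured energy and its covariance quadratic forms -/

/-- The squared norm of the orthogonal projection of `y` onto the span of an orthonormal `v`. -/
noncomputable def energy (v : Fin k → EuclideanSpace ℝ (Fin p)) (y : EuclideanSpace ℝ (Fin p)) : ℝ :=
  ∑ i, ⟪v i, y⟫ ^ 2

lemma energy_nonneg (v : Fin k → EuclideanSpace ℝ (Fin p)) (y : EuclideanSpace ℝ (Fin p)) :
    0 ≤ energy v y := Finset.sum_nonneg fun _ _ ↦ sq_nonneg _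

lemma energy_le_norm_sq {v : Fin k → EuclideanSpace ℝ (Fin p)} (hv : Orthonormal ℝ v)
    (y : EuclideanSpace ℝ (Fin p)) : energy v y ≤ ‖y‖ ^ 2 := by
  simpa [energy] using hv.sum_inner_products_le y (s := Finset.univ)

lemma continuous_energy (v : Fin k → EuclideanSpace ℝ (Fin p)) : Continuous (energy v) := by
  unfold energy; fun_prop

lemma norm_sub_starProjection_span_sq {v : Fin k → EuclideanSpace ℝ (Fin p)}
    (hv : Orthonormal ℝ v) (y : EuclideanSpace ℝ (Fin p)) :
    ‖y - (Submodule.span ℝ (Set.range v)).starProjection y‖ ^ 2 = ‖y‖ ^ 2 - energy v y := by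
  have hproj : (Submodule.span ℝ (Set.range v)).starProjection y = ∑ i, ⟪v i, y⟫ • v i := by
    refine Submodule.eq_starProjection_of_mem_of_inner_eq_zero
      (K := Submodule.span ℝ (Set.range v)) ?_ ?_
    · exact Submodule.sum_mem _ fun i _ ↦
        Submodule.smul_mem _ _ (Submodule.subset_span ⟨i, rfl⟩)
    · intro w hw
      induction hw using Submodule.span_induction with
      | mem x hx =>
        obtain ⟨j, rfl⟩ := hx
        rw [real_inner_comm, inner_sub_right, hv.inner_right_fintype, sub_self]
      | zero => simp
      | add x y _ _ hx hy => rw [inner_add_right, hx, hy, add_zero]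
      | smul a x _ hx => rw [inner_smul_right, hx, mul_zero]
  rw [hproj, norm_sub_sq_real, inner_sum]
  have h1 : ‖∑ i, ⟪v i, y⟫ • v i‖ ^ 2 = energy v y := by
    rw [← real_inner_self_eq_norm_sq, hv.inner_sum]
    simp [energy, pow_two]
  have h2 : ∑ i, ⟪y, ⟪v i, y⟫ • v i⟫ = energy v y := by
    refine Finset.sum_congr rfl fun i _ ↦ ?_
    rw [inner_smul_right, real_inner_comm]; ring
  rw [h1, h2]; ring

lemma inner_sq_eq_sum (y z : EuclideanSpace ℝ (Fin p)) :
    ⟪y, z⟫ ^ 2 = ∑ a, ∑ b, y a * (z a * z b) * y b := by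
  rw [pow_two, PiLp.inner_apply, Finset.sum_mul_sum]
  refine Finset.sum_congr rfl fun a _ ↦ Finset.sum_congr rfl fun b _ ↦ ?_
  simp only [RCLike.inner_apply, conj_trivial]
  ring

lemma inner_empiricalCov {m : ℕ} (x : Fin m → EuclideanSpace ℝ (Fin p))
    (y : EuclideanSpace ℝ (Fin p)) :
    ⟪y, Matrix.toEuclideanLin (empiricalCov x) y⟫ = (1 / (m : ℝ)) * ∑ j, ⟪y, x j⟫ ^ 2 := by
  simp only [inner_toEuclideanLin, inner_sq_eq_sum, empiricalCov, Matrix.of_apply]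
  rw [Finset.sum_comm (s := (Finset.univ : Finset (Fin m))), Finset.mul_sum]
  refine Finset.sum_congr rfl fun a _ ↦ ?_
  rw [Finset.sum_comm (s := (Finset.univ : Finset (Fin m))), Finset.mul_sum]
  refine Finset.sum_congr rfl fun b _ ↦ ?_
  simp only [Finset.mul_sum, Finset.sum_mul]
  exact Finset.sum_congr rfl fun j _ ↦ by ring

lemma sum_inner_empiricalCov {m : ℕ} (x : Fin m → EuclideanSpace ℝ (Fin p))
    (v : Fin k → EuclideanSpace ℝ (Fin p)) :
    ∑ i, ⟪v i, Matrix.toEuclideanLin (empiricalCov x) (v i)⟫ =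
      (1 / (m : ℝ)) * ∑ j, energy v (x j) := by
  simp only [inner_empiricalCov, energy]
  rw [← Finset.mul_sum, Finset.sum_comm]

/-- Top eigenvectors of the empirical covariance capture the most empirical energy. -/
lemma sum_energy_le_of_isTopEigenvectors {m : ℕ} (x : Fin m → EuclideanSpace ℝ (Fin p))
    (hk : k ≤ p) {u v : Fin k → EuclideanSpace ℝ (Fin p)} (hu : Orthonormal ℝ u)
    (hv : IsTopEigenvectors (empiricalCov_isHermitian x) hk v) :
    (1 / (m : ℝ)) * ∑ j, energy u (x j) ≤ (1 / (m : ℝ)) * ∑ j, energy v (x j) := by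
  rw [← sum_inner_empiricalCov, ← sum_inner_empiricalCov]
  refine (sum_inner_toEuclideanLin_le (empiricalCov_isHermitian x) hk hu).trans_eq ?_
  refine Finset.sum_congr rfl fun i _ ↦ ?_
  rw [hv.2 i, inner_smul_right, real_inner_self_eq_norm_sq, hv.1.1 i]
  simp

lemma norm_pow_four_eq_sum (y : EuclideanSpace ℝ (Fin p)) :
    ‖y‖ ^ 4 = ∑ a, ∑ b, (y a * y b) ^ 2 := by
  have : ‖y‖ ^ 4 = (‖y‖ ^ 2) * (‖y‖ ^ 2) := by ring
  rw [this, EuclideanSpace.real_norm_sq_eq, Finset.sum_mul_sum]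
  simp only [mul_pow]

/-- Cauchy-Schwarz in each entry. This makes the empirical half of C nonnegative. -/
lemma sum_sortedEig_sq_empiricalCov_le {m : ℕ} (x : Fin m → EuclideanSpace ℝ (Fin p)) :
    ∑ i, sortedEig (empiricalCov_isHermitian x) i ^ 2 ≤ (1 / (m : ℝ)) * ∑ j, ‖x j‖ ^ 4 := by
  simp only [sum_sortedEig_sq, norm_pow_four_eq_sum, empiricalCov, Matrix.of_apply]
  rw [Finset.sum_comm (s := (Finset.univ : Finset (Fin m))), Finset.mul_sum]
  refine Finset.sum_le_sum fun a _ ↦ ?_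
  rw [Finset.sum_comm (s := (Finset.univ : Finset (Fin m))), Finset.mul_sum]
  refine Finset.sum_le_sum fun b _ ↦ ?_
  rcases Nat.eq_zero_or_pos m with rfl | hm
  · simp
  have h := sq_sum_le_card_mul_sum_sq (s := (Finset.univ : Finset (Fin m)))
    (f := fun j ↦ x j a * x j b)
  have hm' : (0 : ℝ) < m := by exact_mod_cast hm
  simp only [Finset.card_univ, Fintype.card_fin] at h
  calc (1 / (m : ℝ) * ∑ j, x j a * x j b) ^ 2
      = (1 / (m : ℝ)) ^ 2 * (∑ j, x j a * x j b) ^ 2 := by ring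
    _ ≤ (1 / (m : ℝ)) ^ 2 * (m * ∑ j, (x j a * x j b) ^ 2) := by gcongr
    _ = _ := by field_simp

/-- By Cauchy-Schwarz, the quadratic form of `A` summed over `k` orthonormal vectors is bounded by
`√k` times the Frobenius norm of `A`. -/
lemma sum_inner_toEuclideanLin_le_sqrt {A : Matrix (Fin p) (Fin p) ℝ}
    {v : Fin k → EuclideanSpace ℝ (Fin p)} (hv : Orthonormal ℝ v) :
    ∑ i, ⟪v i, Matrix.toEuclideanLin A (v i)⟫ ≤ √(k * ∑ a, ∑ b, A a b ^ 2) := by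
  -- Bessel's inequality for `v`, applied to each row of `A`.
  have h1 : ∑ i, ‖Matrix.toEuclideanLin A (v i)‖ ^ 2 ≤ ∑ a, ∑ b, A a b ^ 2 := by
    simp only [EuclideanSpace.real_norm_sq_eq]
    rw [Finset.sum_comm]
    refine Finset.sum_le_sum fun a _ ↦ ?_
    have := hv.sum_inner_products_le (WithLp.toLp 2 (A a)) (s := Finset.univ)
    rw [EuclideanSpace.real_norm_sq_eq] at this
    refine (le_of_eq ?_).trans this
    refine Finset.sum_congr rfl fun i _ ↦ ?_
    simp only [Matrix.toLpLin_apply, Matrix.mulVec, dotProduct, PiLp.inner_apply,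
      RCLike.inner_apply, conj_trivial, Real.norm_eq_abs, sq_abs]
  refine Real.le_sqrt_of_sq_le ?_
  calc (∑ i, ⟪v i, Matrix.toEuclideanLin A (v i)⟫) ^ 2
      ≤ k * ∑ i, ⟪v i, Matrix.toEuclideanLin A (v i)⟫ ^ 2 := by
        simpa using sq_sum_le_card_mul_sum_sq (s := (Finset.univ : Finset (Fin k)))
          (f := fun i ↦ ⟪v i, Matrix.toEuclideanLin A (v i)⟫)
    _ ≤ k * ∑ i, ‖Matrix.toEuclideanLin A (v i)‖ ^ 2 := by
        refine mul_le_mul_of_nonneg_left (Finset.sum_le_sum fun i _ ↦ ?_) k.cast_nonneg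
        have h := abs_real_inner_le_norm (v i) (Matrix.toEuclideanLin A (v i))
        rw [hv.1 i, one_mul] at h
        exact sq_le_sq' (abs_le.1 h).1 (abs_le.1 h).2
    _ ≤ _ := by gcongr

end AnchorPCA

namespace AnchorPCA

open scoped RealInnerProductSpace

variable {p k m : ℕ}

/-! ### Moments of an almost surely bounded law -/

section BoundedLaw

variable {P : Measure (EuclideanSpace ℝ (Fin p))} [IsProbabilityMeasure P] {T : ℝ}

/-- `P` is carried by a compact ball, on which a continuous function is bounded. -/
lemma memLp_of_continuous (hT : ∀ᵐ x ∂P, ‖x‖ ^ 2 < T) {f : EuclideanSpace ℝ (Fin p) → ℝ}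
    (hf : Continuous f) (q : ENNReal) : MemLp f q P := by
  obtain ⟨C, hC⟩ := (isCompact_closedBall (0 : EuclideanSpace ℝ (Fin p))
    (√T)).exists_bound_of_continuousOn hf.continuousOn
  refine MemLp.of_bound hf.measurable.aestronglyMeasurable C ?_
  filter_upwards [hT] with x hx
  exact hC x (by simpa using Real.le_sqrt_of_sq_le hx.le)

lemma integrable_of_continuous (hT : ∀ᵐ x ∂P, ‖x‖ ^ 2 < T) {f : EuclideanSpace ℝ (Fin p) → ℝ}
    (hf : Continuous f) : Integrable f P :=
  memLp_one_iff_integrable.1 (memLp_of_continuous hT hf 1)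

lemma sum_inner_populationCov (hT : ∀ᵐ x ∂P, ‖x‖ ^ 2 < T)
    (v : Fin k → EuclideanSpace ℝ (Fin p)) :
    ∑ i, ⟪v i, Matrix.toEuclideanLin (populationCov P) (v i)⟫ = ∫ y, energy v y ∂P := by
  have hint : ∀ {f : EuclideanSpace ℝ (Fin p) → ℝ}, Continuous f → Integrable f P :=
    fun hf ↦ integrable_of_continuous hT hf
  simp only [energy]
  rw [integral_finsetSum _ fun i _ ↦ hint (by fun_prop)]
  refine Finset.sum_congr rfl fun i _ ↦ ?_
  simp only [inner_toEuclideanLin, inner_sq_eq_sum, populationCov, Matrix.of_apply]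
  rw [integral_finsetSum _ fun a _ ↦ hint (by fun_prop)]
  refine Finset.sum_congr rfl fun a _ ↦ ?_
  rw [integral_finsetSum _ fun b _ ↦ hint (by fun_prop)]
  refine Finset.sum_congr rfl fun b _ ↦ ?_
  rw [integral_mul_const, integral_const_mul]

lemma trace_populationCov (hT : ∀ᵐ x ∂P, ‖x‖ ^ 2 < T) :
    (populationCov P).trace = ∫ y, ‖y‖ ^ 2 ∂P := by
  simp only [EuclideanSpace.real_norm_sq_eq]
  rw [integral_finsetSum _ fun a _ ↦ integrable_of_continuous hT (by fun_prop)]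
  simp [Matrix.trace, populationCov, pow_two]

lemma expectedResidual_eq (hT : ∀ᵐ x ∂P, ‖x‖ ^ 2 < T)
    {v : Fin k → EuclideanSpace ℝ (Fin p)} (hv : Orthonormal ℝ v) :
    expectedResidual P v = (populationCov P).trace - ∫ y, energy v y ∂P := by
  rw [trace_populationCov hT, ← integral_sub (integrable_of_continuous hT (by fun_prop))
    (integrable_of_continuous hT (continuous_energy v))]
  exact integral_congr_ae (.of_forall fun y ↦ norm_sub_starProjection_span_sq hv y)

/-- The top eigenvectors of the population covariance attain the sum of the remaining
eigenvalues as their expected residual. -/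
lemma exists_orthonormal_integral_energy_eq (hT : ∀ᵐ x ∂P, ‖x‖ ^ 2 < T) (hk : k ≤ p) :
    ∃ u : Fin k → EuclideanSpace ℝ (Fin p), Orthonormal ℝ u ∧
      ∑ i : Fin p with k ≤ i.val, sortedEig (populationCov_isHermitian P) i =
        (populationCov P).trace - ∫ y, energy u y ∂P := by
  obtain ⟨b, hb⟩ := exists_orthonormalBasis_sortedEig (populationCov_isHermitian P)
  refine ⟨fun i ↦ b (Fin.castLE hk i),
    b.orthonormal.comp _ (Fin.castLE_injective hk), ?_⟩
  rw [sum_sortedEig_filter _ hk, ← sum_inner_populationCov hT]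
  simp [hb, inner_smul_right]

/-- The sum of the variances of the entries of `x xᵀ`. -/
lemma sum_variance_mul_apply (hT : ∀ᵐ x ∂P, ‖x‖ ^ 2 < T) :
    ∑ a, ∑ b, Var[fun x : EuclideanSpace ℝ (Fin p) ↦ x a * x b; P] =
      (∫ y, ‖y‖ ^ 4 ∂P) - ∑ i, sortedEig (populationCov_isHermitian P) i ^ 2 := by
  have hint : ∀ {f : EuclideanSpace ℝ (Fin p) → ℝ}, Continuous f → Integrable f P :=
    fun hf ↦ integrable_of_continuous hT hf
  simp only [sum_sortedEig_sq, norm_pow_four_eq_sum]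
  rw [integral_finsetSum _ fun a _ ↦ hint (by fun_prop), ← Finset.sum_sub_distrib]
  refine Finset.sum_congr rfl fun a _ ↦ ?_
  rw [integral_finsetSum _ fun b _ ↦ hint (by fun_prop), ← Finset.sum_sub_distrib]
  refine Finset.sum_congr rfl fun b _ ↦ ?_
  rw [variance_eq_sub (memLp_of_continuous hT (by fun_prop) 2)]
  rfl

/-- Each entry of Ŝ is an average of `m` independent copies with mean the entry of Σ, so its mean
squared error is a variance divided by `m`. -/
lemma integral_empiricalCov_sub_sq (hm : 0 < m) (hT : ∀ᵐ x ∂P, ‖x‖ ^ 2 < T) (a b : Fin p) :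
    Integrable (fun x : Fin m → EuclideanSpace ℝ (Fin p) ↦
      (empiricalCov x - populationCov P) a b ^ 2) (Measure.pi fun _ ↦ P) ∧
    ∫ x : Fin m → EuclideanSpace ℝ (Fin p), (empiricalCov x - populationCov P) a b ^ 2
      ∂(Measure.pi fun _ ↦ P) =
      Var[fun x : EuclideanSpace ℝ (Fin p) ↦ x a * x b; P] / m := by
  have hm' : (m : ℝ) ≠ 0 := by exact_mod_cast hm.ne'
  have hLp : MemLp (fun x : EuclideanSpace ℝ (Fin p) ↦ x a * x b) 2 P :=
    memLp_of_continuous hT (by fun_prop) 2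
  set X : (Fin m → EuclideanSpace ℝ (Fin p)) → ℝ :=
    fun x ↦ (1 / (m : ℝ)) * (∑ j, fun z : Fin m → EuclideanSpace ℝ (Fin p) ↦ z j a * z j b) x
    with hX
  have hXe : ∀ x, empiricalCov x a b = X x := fun x ↦ by
    simp [hX, empiricalCov]
  have hXLp : MemLp X 2 (Measure.pi fun _ ↦ P) :=
    (memLp_finsetSum' _ fun j _ ↦
      hLp.comp_measurePreserving (measurePreserving_eval (fun _ ↦ P) j)).const_mul _
  have hmean : ∫ x, X x ∂(Measure.pi fun _ ↦ P) = populationCov P a b := by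
    simp only [hX, Finset.sum_apply]
    rw [integral_const_mul, integral_finsetSum]
    · have : ∀ j : Fin m, ∫ z : Fin m → EuclideanSpace ℝ (Fin p), z j a * z j b
          ∂(Measure.pi fun _ ↦ P) = populationCov P a b := fun j ↦
        integral_comp_eval (μ := fun _ ↦ P) (i := j) hLp.aestronglyMeasurable
      simp only [this, Finset.sum_const, Finset.card_univ, Fintype.card_fin, nsmul_eq_mul]
      field_simp
    · exact fun j _ ↦ integrable_comp_eval (μ := fun _ ↦ P) (i := j)
        (hLp.integrable one_le_two)
  simp only [Matrix.sub_apply, hXe]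
  refine ⟨(hXLp.sub (memLp_const _)).integrable_sq, ?_⟩
  rw [← hmean, ← variance_eq_integral hXLp.aemeasurable, hX, variance_const_mul,
    variance_sum_pi (μ := fun _ : Fin m ↦ P)
      (X := fun _ (x : EuclideanSpace ℝ (Fin p)) ↦ x a * x b) (fun _ ↦ hLp)]
  simp only [Finset.sum_const, Finset.card_univ, Fintype.card_fin, nsmul_eq_mul]
  field_simp

end BoundedLaw

/-- Jensen for the square root, read off from the nonnegativity of the variance of `√W`. -/
lemma integral_sqrt_le {α : Type*} [MeasurableSpace α] {ν : Measure α} [IsProbabilityMeasure ν]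
    {W : α → ℝ} (hW : Integrable W ν) (h0 : ∀ x, 0 ≤ W x) :
    Integrable (fun x ↦ √(W x)) ν ∧ ∫ x, √(W x) ∂ν ≤ √(∫ x, W x ∂ν) := by
  have hLp : MemLp (fun x ↦ √(W x)) 2 ν := by
    rw [memLp_two_iff_integrable_sq (Real.continuous_sqrt.comp_aestronglyMeasurable hW.1)]
    simpa [Real.sq_sqrt (h0 _)] using hW
  refine ⟨hLp.integrable one_le_two, Real.le_sqrt_of_sq_le ?_⟩
  have h := variance_nonneg (fun x ↦ √(W x)) ν
  rw [variance_eq_sub hLp] at h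
  have h2 : ∫ x, ((fun x ↦ √(W x)) ^ 2) x ∂ν = ∫ x, W x ∂ν := by
    simp [Real.sq_sqrt (h0 _)]
  rw [h2] at h
  linarith

/-! ### The uniform deviation: measurability, bounded differences and mean -/

section UniformDeviation

/-- How much better, relative to `u`, the family `v` fares on the sample `x` than on the law `P`. -/
noncomputable def deviation (P : Measure (EuclideanSpace ℝ (Fin p)))
    (u v : Fin k → EuclideanSpace ℝ (Fin p)) (x : Fin m → EuclideanSpace ℝ (Fin p)) : ℝ :=
  (1 / (m : ℝ)) * ∑ j, (energy v (x j) - energy u (x j)) -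
    (∫ y, energy v y ∂P - ∫ y, energy u y ∂P)

/-- The supremum of `deviation P u v x` over orthonormal families `v`. -/
noncomputable def supDeviation (P : Measure (EuclideanSpace ℝ (Fin p)))
    (u : Fin k → EuclideanSpace ℝ (Fin p)) (x : Fin m → EuclideanSpace ℝ (Fin p)) : ℝ :=
  ⨆ v : {v : Fin k → EuclideanSpace ℝ (Fin p) // Orthonormal ℝ v}, deviation P u v x

variable {P : Measure (EuclideanSpace ℝ (Fin p))} {u : Fin k → EuclideanSpace ℝ (Fin p)}

lemma bddAbove_deviation (x : Fin m → EuclideanSpace ℝ (Fin p)) :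
    BddAbove (Set.range fun v : {v : Fin k → EuclideanSpace ℝ (Fin p) // Orthonormal ℝ v} ↦
      deviation P u v x) := by
  refine ⟨(1 / (m : ℝ)) * ∑ j, ‖x j‖ ^ 2 + ∫ y, energy u y ∂P, ?_⟩
  rintro _ ⟨v, rfl⟩
  have h1 : (0 : ℝ) ≤ ∫ y, energy v.1 y ∂P := integral_nonneg (energy_nonneg _)
  have h2 : (1 / (m : ℝ)) * ∑ j, (energy v.1 (x j) - energy u (x j)) ≤
      (1 / (m : ℝ)) * ∑ j, ‖x j‖ ^ 2 := by
    gcongr with j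
    linarith [energy_le_norm_sq v.2 (x j), energy_nonneg u (x j)]
  simp only [deviation]
  linarith

/-- The supremum is uncountable, but a supremum of continuous functions is lower semicontinuous. -/
lemma measurable_supDeviation :
    Measurable (supDeviation P u : (Fin m → EuclideanSpace ℝ (Fin p)) → ℝ) := by
  refine (lowerSemicontinuous_ciSup bddAbove_deviation fun v ↦ ?_).measurable
  have h := continuous_energy v.1
  have h' := continuous_energy u
  exact Continuous.lowerSemicontinuous (by unfold deviation; fun_prop)

/-- Replacing `y` by `0` unless `‖y‖ ^ 2 < T`. -/
noncomputable def truncate (T : ℝ) (y : EuclideanSpace ℝ (Fin p)) : EuclideanSpace ℝ (Fin p) :=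
  open Classical in if ‖y‖ ^ 2 < T then y else 0

lemma norm_truncate_sq_le {T : ℝ} (hT : 0 ≤ T) (y : EuclideanSpace ℝ (Fin p)) :
    ‖truncate T y‖ ^ 2 ≤ T := by
  unfold truncate
  split_ifs with h
  · exact h.le
  · simpa using hT

lemma measurable_truncate (T : ℝ) : Measurable (truncate T : EuclideanSpace ℝ (Fin p) → _) := by
  classical
  exact Measurable.ite (measurableSet_lt (by fun_prop) measurable_const) measurable_id
    measurable_const

lemma abs_ciSup_sub_ciSup_le {ι : Type*} [Nonempty ι] {f g : ι → ℝ} {c : ℝ}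
    (hf : BddAbove (Set.range f)) (hg : BddAbove (Set.range g)) (h : ∀ i, |f i - g i| ≤ c) :
    |(⨆ i, f i) - ⨆ i, g i| ≤ c := by
  rw [abs_sub_le_iff]
  constructor
  · rw [sub_le_iff_le_add]
    exact ciSup_le fun i ↦ by linarith [(abs_le.1 (h i)).2, le_ciSup hg i]
  · rw [sub_le_iff_le_add]
    exact ciSup_le fun i ↦ by linarith [(abs_le.1 (h i)).1, le_ciSup hf i]

lemma abs_energy_sub_energy_le {v : Fin k → EuclideanSpace ℝ (Fin p)} (hu : Orthonormal ℝ u)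
    (hv : Orthonormal ℝ v) (y : EuclideanSpace ℝ (Fin p)) :
    |energy v y - energy u y| ≤ ‖y‖ ^ 2 := by
  rw [abs_le]
  constructor <;>
  linarith [energy_nonneg u y, energy_nonneg v y, energy_le_norm_sq hu y, energy_le_norm_sq hv y]

/-- An energy difference lies in `[-T, T]` at truncated points and carries weight `1 / m`; a bound
uniform in `v` passes to the supremum. -/
lemma hasBoundedDifferences_supDeviation_truncate (hu : Orthonormal ℝ u) {T : ℝ} (hT : 0 ≤ T) :
    HasBoundedDifferences
      (fun x : Fin m → EuclideanSpace ℝ (Fin p) ↦ supDeviation P u fun j ↦ truncate T (x j))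
      (fun _ ↦ (2 * T / m).toNNReal) := by
  intro x j a
  have : Nonempty {v : Fin k → EuclideanSpace ℝ (Fin p) // Orthonormal ℝ v} := ⟨⟨u, hu⟩⟩
  refine abs_ciSup_sub_ciSup_le (bddAbove_deviation _) (bddAbove_deviation _) fun v ↦ ?_
  rw [Real.coe_toNNReal _ (by positivity)]
  set d : EuclideanSpace ℝ (Fin p) → ℝ := fun y ↦ energy v.1 y - energy u y with hd
  have hdT : ∀ y, |d (truncate T y)| ≤ T := fun y ↦
    (abs_energy_sub_energy_le hu v.2 _).trans (norm_truncate_sq_le hT y)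
  have hsum : ∑ i, d (truncate T (Function.update x j a i)) - ∑ i, d (truncate T (x i)) =
      d (truncate T a) - d (truncate T (x j)) := by
    rw [← Finset.sum_sub_distrib, Finset.sum_eq_single j]
    · simp
    · intro i _ hi
      simp [Function.update_of_ne hi]
    · simp
  have : deviation P u v.1 (fun i ↦ truncate T (Function.update x j a i)) -
      deviation P u v.1 (fun i ↦ truncate T (x i)) =
      (1 / (m : ℝ)) * (d (truncate T a) - d (truncate T (x j))) := by
    rw [← hsum]
    simp only [deviation, hd]
    ring
  rw [this, abs_mul, abs_of_nonneg (by positivity)]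
  calc (1 / (m : ℝ)) * |d (truncate T a) - d (truncate T (x j))|
      ≤ (1 / (m : ℝ)) * (T + T) := by
        gcongr
        exact (abs_sub _ _).trans (add_le_add (hdT a) (hdT (x j)))
    _ = 2 * T / m := by ring

variable [IsProbabilityMeasure P] {T : ℝ}

/-- Only the `v` part of the deviation needs a uniform bound, given by the quadratic form of Ŝ − Σ.
The `u` part is kept exactly, since it integrates to zero. -/
lemma supDeviation_le (hT : ∀ᵐ x ∂P, ‖x‖ ^ 2 < T) (hu : Orthonormal ℝ u)
    (x : Fin m → EuclideanSpace ℝ (Fin p)) :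
    supDeviation P u x ≤ √(k * ∑ a, ∑ b, (empiricalCov x - populationCov P) a b ^ 2) -
      ((1 / (m : ℝ)) * ∑ j, energy u (x j) - ∫ y, energy u y ∂P) := by
  have : Nonempty {v : Fin k → EuclideanSpace ℝ (Fin p) // Orthonormal ℝ v} := ⟨⟨u, hu⟩⟩
  refine ciSup_le fun v ↦ ?_
  have h := sum_inner_toEuclideanLin_le_sqrt (A := empiricalCov x - populationCov P) v.2
  simp only [map_sub, LinearMap.sub_apply, inner_sub_right, Finset.sum_sub_distrib,
    sum_inner_empiricalCov, sum_inner_populationCov hT] at h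
  simp only [deviation, Finset.sum_sub_distrib, mul_sub]
  linarith

lemma ae_truncate_eq (hT : ∀ᵐ x ∂P, ‖x‖ ^ 2 < T) :
    ∀ᵐ x : Fin m → EuclideanSpace ℝ (Fin p) ∂(Measure.pi fun _ ↦ P),
      (fun j ↦ truncate T (x j)) = x := by
  have : ∀ j, ∀ᵐ x : Fin m → EuclideanSpace ℝ (Fin p) ∂(Measure.pi fun _ ↦ P),
      ‖x j‖ ^ 2 < T := fun j ↦
    (measurePreserving_eval (fun _ : Fin m ↦ P) j).quasiMeasurePreserving.ae hT
  filter_upwards [ae_all_iff.2 this] with x hx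
  funext j
  simp [truncate, hx j]

lemma integral_supDeviation_truncate_le (hm : 0 < m) (hT : ∀ᵐ x ∂P, ‖x‖ ^ 2 < T) (hT0 : 0 ≤ T)
    (hu : Orthonormal ℝ u) :
    ∫ x : Fin m → EuclideanSpace ℝ (Fin p), supDeviation P u (fun j ↦ truncate T (x j))
      ∂(Measure.pi fun _ ↦ P) ≤
      √(k * ((∫ y, ‖y‖ ^ 4 ∂P) - ∑ i, sortedEig (populationCov_isHermitian P) i ^ 2) / m) := by
  have hm' : (m : ℝ) ≠ 0 := by exact_mod_cast hm.ne'
  set ν : Measure (Fin m → EuclideanSpace ℝ (Fin p)) := Measure.pi fun _ ↦ P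
  have hcov := fun a b ↦ integral_empiricalCov_sub_sq hm hT a b
  have hWi : Integrable (fun x : Fin m → EuclideanSpace ℝ (Fin p) ↦
      (k : ℝ) * ∑ a, ∑ b, (empiricalCov x - populationCov P) a b ^ 2) ν :=
    (integrable_finsetSum _ fun a _ ↦ integrable_finsetSum _ fun b _ ↦ (hcov a b).1).const_mul _
  have hW : ∫ x : Fin m → EuclideanSpace ℝ (Fin p),
      (k : ℝ) * ∑ a, ∑ b, (empiricalCov x - populationCov P) a b ^ 2 ∂ν =
      k * ((∫ y, ‖y‖ ^ 4 ∂P) - ∑ i, sortedEig (populationCov_isHermitian P) i ^ 2) / m := by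
    rw [integral_const_mul, integral_finsetSum _ fun a _ ↦
      integrable_finsetSum _ fun b _ ↦ (hcov a b).1, ← sum_variance_mul_apply hT, mul_div_assoc,
      Finset.sum_div]
    congr 1
    refine Finset.sum_congr rfl fun a _ ↦ ?_
    rw [integral_finsetSum _ fun b _ ↦ (hcov a b).1, Finset.sum_div]
    exact Finset.sum_congr rfl fun b _ ↦ (hcov a b).2
  have hsq := integral_sqrt_le hWi fun x ↦ by positivity
  rw [hW] at hsq
  have hei : Integrable (energy u) P := integrable_of_continuous hT (continuous_energy u)
  have heij : ∀ j : Fin m, Integrable (fun x : Fin m → EuclideanSpace ℝ (Fin p) ↦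
      energy u (x j)) ν := fun j ↦ integrable_comp_eval (μ := fun _ ↦ P) (i := j) hei
  have hsi : Integrable (fun x : Fin m → EuclideanSpace ℝ (Fin p) ↦
      (1 / (m : ℝ)) * ∑ j, energy u (x j)) ν :=
    (integrable_finsetSum _ fun j _ ↦ heij j).const_mul _
  have hmean : ∫ x : Fin m → EuclideanSpace ℝ (Fin p), (1 / (m : ℝ)) * ∑ j, energy u (x j) ∂ν =
      ∫ y, energy u y ∂P := by
    rw [integral_const_mul, integral_finsetSum _ fun j _ ↦ heij j]
    have : ∀ j : Fin m, ∫ x : Fin m → EuclideanSpace ℝ (Fin p), energy u (x j) ∂ν =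
        ∫ y, energy u y ∂P := fun j ↦
      integral_comp_eval (μ := fun _ ↦ P) (i := j) hei.aestronglyMeasurable
    simp only [this, Finset.sum_const, Finset.card_univ, Fintype.card_fin, nsmul_eq_mul]
    field_simp
  have hFi : Integrable (fun x : Fin m → EuclideanSpace ℝ (Fin p) ↦
      supDeviation P u fun j ↦ truncate T (x j)) ν :=
    (hasBoundedDifferences_supDeviation_truncate hu hT0).integrable
      (measurable_supDeviation.comp (measurable_pi_lambda _ fun j ↦
        (measurable_truncate T).comp (measurable_pi_apply j))) ν
  have hci : Integrable (fun x : Fin m → EuclideanSpace ℝ (Fin p) ↦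
      (1 / (m : ℝ)) * ∑ j, energy u (x j) - ∫ y, energy u y ∂P) ν := hsi.sub (integrable_const _)
  calc ∫ x : Fin m → EuclideanSpace ℝ (Fin p), supDeviation P u (fun j ↦ truncate T (x j)) ∂ν
      ≤ ∫ x : Fin m → EuclideanSpace ℝ (Fin p),
          (√(k * ∑ a, ∑ b, (empiricalCov x - populationCov P) a b ^ 2) -
            ((1 / (m : ℝ)) * ∑ j, energy u (x j) - ∫ y, energy u y ∂P)) ∂ν := by
        refine integral_mono_ae hFi (hsq.1.sub hci) ?_
        filter_upwards [ae_truncate_eq hT] with x hx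
        rw [hx]
        exact supDeviation_le hT hu x
    _ = ∫ x : Fin m → EuclideanSpace ℝ (Fin p),
          √(k * ∑ a, ∑ b, (empiricalCov x - populationCov P) a b ^ 2) ∂ν := by
        rw [integral_sub hsq.1 hci, integral_sub hsi (integrable_const _), hmean]
        simp
    _ ≤ _ := hsq.2

end UniformDeviation

end AnchorPCA

/-! ### Concentration and the final bound -/

namespace AnchorPCA

variable {p k m : ℕ} {P : Measure (EuclideanSpace ℝ (Fin p))} [IsProbabilityMeasure P] {T δ : ℝ}

/-- McDiarmid's inequality for the truncated uniform deviation. -/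
lemma measureReal_supDeviation_truncate_ge_le (hm : 0 < m) (hT0 : 0 < T)
    {u : Fin k → EuclideanSpace ℝ (Fin p)} (hu : Orthonormal ℝ u) (hδ : 0 ≤ δ) :
    (Measure.pi fun _ : Fin m ↦ P).real {x | T * √(2 * δ / m) ≤
      supDeviation P u (fun j ↦ truncate T (x j)) -
        ∫ z : Fin m → EuclideanSpace ℝ (Fin p), supDeviation P u (fun j ↦ truncate T (z j))
          ∂(Measure.pi fun _ ↦ P)} ≤ Real.exp (-δ) := by
  have hm' : (0 : ℝ) < m := by exact_mod_cast hm
  have hmeas : Measurable (fun x : Fin m → EuclideanSpace ℝ (Fin p) ↦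
      supDeviation P u fun j ↦ truncate T (x j)) :=
    measurable_supDeviation.comp (measurable_pi_lambda _ fun j ↦
      (measurable_truncate T).comp (measurable_pi_apply j))
  have h := ((hasBoundedDifferences_supDeviation_truncate (P := P) (m := m) hu
    hT0.le).hasSubgaussianMGF hmeas (fun _ ↦ P)).measure_ge_le
    (ε := T * √(2 * δ / m)) (by positivity)
  refine h.trans_eq ?_
  -- The sub-Gaussian parameter is `m * (T / m) ^ 2 = T ^ 2 / m`, which turns the chosen threshold
  -- into exponent `-δ`.
  have h2 : (0 : ℝ) ≤ 2 * T / m := by positivity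
  simp only [Finset.sum_const, Finset.card_univ, Fintype.card_fin, nsmul_eq_mul, NNReal.coe_mul,
    NNReal.coe_natCast, NNReal.coe_pow, NNReal.coe_div, NNReal.coe_ofNat, Real.coe_toNNReal _ h2]
  rw [mul_pow, Real.sq_sqrt (by positivity)]
  congr 1
  field_simp

/-- `v` depends on the sample, which is why the supremum over all families is needed; optimality of
`v` on the sample removes the empirical terms. -/
lemma expectedResidual_le_trace_sub_add_supDeviation (hk : k ≤ p) (hT : ∀ᵐ x ∂P, ‖x‖ ^ 2 < T)
    {u v : Fin k → EuclideanSpace ℝ (Fin p)} (hu : Orthonormal ℝ u)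
    (x : Fin m → EuclideanSpace ℝ (Fin p))
    (hv : IsTopEigenvectors (empiricalCov_isHermitian x) hk v) :
    expectedResidual P v ≤
      (populationCov P).trace - ∫ y, energy u y ∂P + supDeviation P u x := by
  rw [expectedResidual_eq hT hv.1]
  have h1 : deviation P u v x ≤ supDeviation P u x := le_ciSup (bddAbove_deviation x) ⟨v, hv.1⟩
  have h2 := sum_energy_le_of_isTopEigenvectors x hk hu hv
  simp only [deviation, Finset.sum_sub_distrib, mul_sub] at h1
  linarith

end AnchorPCA

open AnchorPCA in
theorem lemma2 {Ω : Type*} [MeasurableSpace Ω] (μ : Measure Ω) [IsProbabilityMeasure μ]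
    {p m k : ℕ} (hm : 0 < m) (hk : k ≤ p)
    (P : Measure (EuclideanSpace ℝ (Fin p))) [IsProbabilityMeasure P]
    (ξ : Fin m → Ω → EuclideanSpace ℝ (Fin p))
    (hlaw : ∀ j, HasLaw (ξ j) P μ) (hindep : iIndepFun ξ μ)
    (T : ℝ) (hT : ∀ᵐ x ∂P, ‖x‖ ^ 2 < T) (δ : ℝ) (hδ : 0 ≤ δ) :
    ∃ A : Set Ω, MeasurableSet A ∧ 1 - 2 * Real.exp (-δ) ≤ μ.real A ∧
      ∀ ω ∈ A, ∀ v : Fin k → EuclideanSpace ℝ (Fin p),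
        AnchorPCA.IsTopEigenvectors
            (AnchorPCA.empiricalCov_isHermitian fun j => ξ j ω) hk v →
          AnchorPCA.expectedResidual P v ≤
            (∑ i : Fin p with k ≤ i.val,
                AnchorPCA.sortedEig (AnchorPCA.populationCov_isHermitian P) i)
              + √(k * AnchorPCA.fourthMomentTerm P (fun j => ξ j ω) / m)
              + T * √(2 * δ / m) := by
  have hT0 : 0 < T := by
    obtain ⟨x, hx⟩ := hT.exists
    exact (sq_nonneg _).trans_lt hx
  obtain ⟨u, hu, hsum⟩ := exists_orthonormal_integral_energy_eq hT hk
  set ν : Measure (Fin m → EuclideanSpace ℝ (Fin p)) := Measure.pi fun _ ↦ P with hν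
  set F : (Fin m → EuclideanSpace ℝ (Fin p)) → ℝ :=
    fun x ↦ supDeviation P u fun j ↦ truncate T (x j) with hF
  have hFm : Measurable F := measurable_supDeviation.comp (measurable_pi_lambda _ fun j ↦
    (measurable_truncate T).comp (measurable_pi_apply j))
  have htail : ν.real {x | T * √(2 * δ / m) ≤ F x - ∫ z, F z ∂ν} ≤ Real.exp (-δ) :=
    measureReal_supDeviation_truncate_ge_le hm hT0 hu hδ
  set S : Set (Fin m → EuclideanSpace ℝ (Fin p)) :=
    {x | T * √(2 * δ / m) ≤ F x - ∫ z, F z ∂ν} with hS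
  have hSm : MeasurableSet S := measurableSet_le measurable_const (hFm.sub_const _)
  have hX : AEMeasurable (fun ω j ↦ ξ j ω) μ := aemeasurable_pi_lambda _ fun j ↦
    (hlaw j).aemeasurable
  have hmap : μ.map (fun ω j ↦ ξ j ω) = ν := by
    rw [(iIndepFun_iff_map_fun_eq_pi_map fun j ↦ (hlaw j).aemeasurable).1 hindep]
    simp only [(hlaw _).map_eq, hν]
  have hG : ∀ᵐ x ∂ν, (fun j ↦ truncate T (x j)) = x := ae_truncate_eq hT
  have hGω : ∀ᵐ ω ∂μ, (fun j ↦ truncate T (ξ j ω)) = fun j ↦ ξ j ω :=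
    ae_of_ae_map hX (hmap ▸ hG)
  -- The `ξ j` are only almost everywhere measurable, so the good events are null-measurable; `N`
  -- and `G` are measurable subsets of full measure in them.
  obtain ⟨N, hNsub, hNm, hN⟩ :=
    (hX.nullMeasurableSet_preimage hSm.compl).exists_measurable_subset_ae_eq
  obtain ⟨G, hGsub, hGm, hGμ⟩ :=
    (NullMeasurableSet.of_compl (s := {ω | (fun j ↦ truncate T (ξ j ω)) = fun j ↦ ξ j ω})
      (NullMeasurableSet.of_null (mem_ae_iff.1 hGω))).exists_measurable_subset_ae_eq
  refine ⟨N ∩ G, hNm.inter hGm, ?_, ?_⟩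
  · have hG1 : G =ᵐ[μ] Set.univ := hGμ.trans (Filter.eventuallyEq_univ.2 hGω)
    have hNG : (N ∩ G : Set Ω) =ᵐ[μ] (fun ω j ↦ ξ j ω) ⁻¹' Sᶜ := by
      simpa using hN.inter hG1
    have hval : μ.real ((fun ω j ↦ ξ j ω) ⁻¹' Sᶜ) = 1 - ν.real S := by
      rw [← probReal_compl_eq_one_sub hSm, ← hmap,
        map_measureReal_apply_of_aemeasurable hX hSm.compl]
    rw [measureReal_congr hNG, hval]
    -- Only one tail of mass `exp(-δ)` has been spent; the factor 2 is slack.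
    linarith [Real.exp_pos (-δ)]
  · rintro ω ⟨hωN, hωG⟩ v hv
    have h1 : F (fun j ↦ ξ j ω) - ∫ z, F z ∂ν < T * √(2 * δ / m) := not_le.1 (hNsub hωN)
    have h2 : F (fun j ↦ ξ j ω) = supDeviation P u fun j ↦ ξ j ω :=
      congrArg (supDeviation P u) (hGsub hωG)
    have h3 : ∫ z, F z ∂ν ≤ _ := integral_supDeviation_truncate_le hm hT hT0.le hu
    have h4 := expectedResidual_le_trace_sub_add_supDeviation hk hT hu _ hv
    have h5 : √(k * ((∫ y, ‖y‖ ^ 4 ∂P) -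
        ∑ i, sortedEig (populationCov_isHermitian P) i ^ 2) / m) ≤
        √(k * fourthMomentTerm P (fun j ↦ ξ j ω) / m) := by
      gcongr
      simp only [fourthMomentTerm]
      linarith [sum_sortedEig_sq_empiricalCov_le fun j ↦ ξ j ω]
    rw [hsum]
    linarith
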